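/- Let $\mathbb K$ be a discrete field. A Hausdorff topological $\mathbb K$-vector space $V$ is \emph{linearly compact} if it has a neighbourhood basis at $0$ consisting of linear subspaces and every collection of closed linear varieties (cosets of linear subspaces) of $V$ with the finite intersection property has non-empty intersection. Let $V$ be linearly compact and let $\phi\colon V\to V$ be a continuous linear endomorphism. Let $\mathcal B(V)$ be the set of linearly compact open linear subspaces of $V$. For $U\in\mathcal B(V)$ and $n>0$ put $$C_n(\phi,U)=U\cap\phi^{-1}U\cap\dots\cap\phi^{-n+1}U,\qquad C(\phi,U)=\bigcap_{n>0}C_n(\phi,U),$$ $$H^*(\phi,U)=\lim_{n\to\infty}\tfrac1n\dim_{\mathbb K}\bigl(U/C_n(\phi,U)\bigr),\qquad \mathrm{ent}^*(V,\phi)=\sup_{U\in\mathcal B(V)}H^*(\phi,U).$$ The $\phi$-cotrajectory $C(\phi,U)$ is \emph{cocyclic} if $\dim_{\mathbb K}(V/U)=1$, and \emph{non-stationary} if it is not open in $V$. A finite family $\{N_i\mid i\in I\}$ of proper subspaces of $V$ is \emph{coindependent} if $N_i+\bigcap_{j\ne i}N_j=V$ for all $i\in I$ (an empty intersection being $V$);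 an arbitrary family of proper subspaces is coindependent if every finite subfamily is. Then, for every $k\in\mathbb N=\{0,1,2,\dots\}$, the following are equivalent: a) $\mathrm{ent}^*(V,\phi)=k$; b) there exist $k$ coindependent non-stationary cocyclic $\phi$-cotrajectories $C(\phi,U_1),\dots,C(\phi,U_k)$, with $U_i\in\mathcal B(V)$, such that $\mathrm{ent}^*(C,\phi\restriction_C)=0$, where $C=\bigcap_{i=1}^kC(\phi,U_i)$ (and $C=V$ if $k=0$). Moreover, $\mathrm{ent}^*(V,\phi)=\infty$ if and only if there exists a countably infinite coindependent family of non-stationary cocyclic $\phi$-cotrajectories. -/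

import Mathlib

open Filter Topology
open scoped ENNReal

namespace TopFlow

section LinearlyCompact

variable (K : Type*) {V : Type*} [Field K] [AddCommGroup V] [Module K V]

/-- A linear variety of `V`: a coset `v + W` of a linear subspace `W`. -/
def IsLinearVariety (A : Set V) : Prop :=
  ∃ (v : V) (W : Submodule K V), A = (fun w => v + w) '' (W : Set V)

variable (V) in
/-- The topological vector space `V` over the discrete field `K` is linearly compact: it is
Hausdorff, `0` has a neighbourhood basis of linear subspaces, and every collection of closed
linear varieties of `V` with the finite intersection property has non-empty intersection. -/
structure IsLinearlyCompact [TopologicalSpace V] : Prop where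
  t2 : T2Space V
  linearTopology : IsLinearTopology K V
  sInter_nonempty : ∀ S : Set (Set V),
    (∀ A ∈ S, IsClosed A ∧ IsLinearVariety K A) →
    (∀ T : Finset (Set V), (T : Set (Set V)) ⊆ S → (⋂₀ (T : Set (Set V))).Nonempty) →
    (⋂₀ S).Nonempty

variable (V) in
/-- `𝓑(V)`: the set of linearly compact open linear subspaces of `V`. -/
def openLC [TopologicalSpace V] : Set (Submodule K V) :=
  {U | IsOpen (U : Set V) ∧ IsLinearlyCompact K U}

end LinearlyCompact

section Cotrajectory

variable {K V : Type*} [Field K] [AddCommGroup V] [Module K V]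

/-- The partial cotrajectory `Cₙ(φ, U) = U ∩ φ⁻¹U ∩ ⋯ ∩ φ⁻ⁿ⁺¹U`. -/
def partialCotraj (φ : V →ₗ[K] V) (U : Submodule K V) (n : ℕ) : Submodule K V :=
  ⨅ i : Fin n, U.comap (φ ^ (i : ℕ))

/-- The cotrajectory `C(φ, U) = ⋂ₙ Cₙ(φ, U)`, over `n > 0`. -/
def cotraj (φ : V →ₗ[K] V) (U : Submodule K V) : Submodule K V :=
  ⨅ (n : ℕ) (_ : 0 < n), partialCotraj φ U n

theorem mem_partialCotraj {φ : V →ₗ[K] V} {U : Submodule K V} {n : ℕ} {x : V} :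
    x ∈ partialCotraj φ U n ↔ ∀ i < n, (φ ^ i) x ∈ U := by
  simp only [partialCotraj, Submodule.mem_iInf, Submodule.mem_comap]
  exact ⟨fun h i hi => h ⟨i, hi⟩, fun h i => h i i.2⟩

theorem mem_cotraj {φ : V →ₗ[K] V} {U : Submodule K V} {x : V} :
    x ∈ cotraj φ U ↔ ∀ i : ℕ, (φ ^ i) x ∈ U := by
  simp only [cotraj, Submodule.mem_iInf, mem_partialCotraj]
  exact ⟨fun h i => h (i + 1) i.succ_pos i i.lt_succ_self, fun h _ _ i _ => h i⟩

/-- An intersection of cotrajectories is `φ`-invariant. -/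
theorem map_mem_iInf_cotraj {ι : Sort*} (φ : V →ₗ[K] V) (U : ι → Submodule K V) :
    ∀ x ∈ ⨅ i, cotraj φ (U i), φ x ∈ ⨅ i, cotraj φ (U i) := by
  intro x hx
  simp only [Submodule.mem_iInf, mem_cotraj] at hx ⊢
  intro i n
  have h := hx i (n + 1)
  rwa [pow_succ, Module.End.mul_apply] at h

/-- `dim_K (U / Cₙ(φ, U))`, in `ℕ ∪ {∞}`. -/
noncomputable def codimCotraj (φ : V →ₗ[K] V) (U : Submodule K V) (n : ℕ) : ℕ∞ :=
  Cardinal.toENat (Module.rank K (U ⧸ (partialCotraj φ U n).submoduleOf U))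

/-- `H*(φ, U) = lim (1/n) dim (U / Cₙ(φ, U))`. The limit always exists, see
`tendsto_entropyAt`. -/
noncomputable def entropyAt (φ : V →ₗ[K] V) (U : Submodule K V) : ℝ≥0∞ :=
  limUnder atTop fun n : ℕ => (codimCotraj φ U n : ℝ≥0∞) / (n : ℝ≥0∞)

/-- The increment of `codimCotraj`. -/
noncomputable def incr (φ : V →ₗ[K] V) (U : Submodule K V) (n : ℕ) : ℕ∞ :=
  Module.length K
    (partialCotraj φ U n ⧸ (partialCotraj φ U (n + 1)).submoduleOf (partialCotraj φ U n))

theorem partialCotraj_succ_le (φ : V →ₗ[K] V) (U : Submodule K V) (n : ℕ) :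
    partialCotraj φ U (n + 1) ≤ partialCotraj φ U n := by
  intro x hx
  rw [mem_partialCotraj] at hx ⊢
  exact fun i hi => hx i (by omega)

theorem codim_succ (φ : V →ₗ[K] V) (U : Submodule K V) (n : ℕ) (hn : 0 < n) :
    codimCotraj φ U (n + 1) = incr φ U n + codimCotraj φ U n := by
  have hU : partialCotraj φ U n ≤ U := by
    intro x hx
    rw [mem_partialCotraj] at hx
    simpa using hx 0 hn
  have hle := partialCotraj_succ_le φ U n
  simp only [codimCotraj, incr, ← Module.length_eq_rank]
  set C := partialCotraj φ U n
  set D := partialCotraj φ U (n + 1)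
  let f : (C ⧸ D.submoduleOf C) →ₗ[K] (U ⧸ D.submoduleOf U) :=
    Submodule.mapQ _ _ (Submodule.inclusion hU) (by
      intro x hx
      simpa [Submodule.submoduleOf] using hx)
  let g : (U ⧸ D.submoduleOf U) →ₗ[K] (U ⧸ C.submoduleOf U) :=
    Submodule.factor (Submodule.comap_mono hle)
  refine Module.length_eq_add_of_exact f g ?_ ?_ ?_
  · rw [← LinearMap.ker_eq_bot, LinearMap.ker_eq_bot']
    intro m
    induction m using Submodule.Quotient.induction_on with
    | H x =>
      intro h
      simp only [f, Submodule.mapQ_apply] at h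
      rw [Submodule.Quotient.mk_eq_zero] at h ⊢
      simpa [Submodule.submoduleOf] using h
  · exact Submodule.factor_surjective _
  · intro y
    induction y using Submodule.Quotient.induction_on with
    | H y =>
      constructor
      · intro h
        have h' : y ∈ C.submoduleOf U := by
          rw [← Submodule.Quotient.mk_eq_zero]
          exact h
        exact ⟨Submodule.Quotient.mk ⟨y, h'⟩, rfl⟩
      · rintro ⟨x, hx⟩
        induction x using Submodule.Quotient.induction_on with
        | H x =>
          rw [← hx]
          change (Submodule.Quotient.mk (Submodule.inclusion hU x) : U ⧸ C.submoduleOf U) = 0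
          rw [Submodule.Quotient.mk_eq_zero]
          exact x.2

theorem incr_antitone (φ : V →ₗ[K] V) (U : Submodule K V) : Antitone (incr φ U) := by
  refine antitone_nat_of_succ_le fun n => ?_
  have key : ∀ m, ∀ x ∈ partialCotraj φ U (m + 1), φ x ∈ partialCotraj φ U m := by
    intro m x hx
    rw [mem_partialCotraj] at hx ⊢
    intro i hi
    have := hx (i + 1) (by omega)
    rwa [pow_succ, Module.End.mul_apply] at this
  let f := Submodule.mapQ ((partialCotraj φ U (n + 1 + 1)).submoduleOf (partialCotraj φ U (n + 1)))
    ((partialCotraj φ U (n + 1)).submoduleOf (partialCotraj φ U n))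
    (φ.restrict (key n)) (fun x hx => key (n + 1) _ hx)
  refine Module.length_le_of_injective f ?_
  rw [← LinearMap.ker_eq_bot, LinearMap.ker_eq_bot']
  intro m
  induction m using Submodule.Quotient.induction_on with
  | H x =>
    intro h
    have h0 : φ.restrict (key n) x ∈
        (partialCotraj φ U (n + 1)).submoduleOf (partialCotraj φ U n) := by
      rw [← Submodule.Quotient.mk_eq_zero]
      exact h
    rw [Submodule.Quotient.mk_eq_zero]
    have h1 : φ (x : V) ∈ partialCotraj φ U (n + 1) := h0
    have h2 := x.2
    change (x : V) ∈ partialCotraj φ U (n + 1 + 1)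
    rw [mem_partialCotraj] at h1 h2 ⊢
    intro i hi
    rcases i with _ | i
    · exact h2 0 (by omega)
    · have := h1 i (by omega)
      rwa [← Module.End.mul_apply, ← pow_succ] at this

/-- The limit in the definition of `entropyAt` exists. -/
theorem tendsto_entropyAt (φ : V →ₗ[K] V) (U : Submodule K V) :
    Tendsto (fun n : ℕ => (codimCotraj φ U n : ℝ≥0∞) / (n : ℝ≥0∞)) atTop
      (𝓝 (entropyAt φ U)) := by
  refine tendsto_nhds_limUnder ?_
  by_cases h : ∃ N, 0 < N ∧ codimCotraj φ U N = ⊤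
  · obtain ⟨N, hN, hT⟩ := h
    have hall : ∀ n, N ≤ n → codimCotraj φ U n = ⊤ := by
      intro n hn
      induction n, hn using Nat.le_induction with
      | base => exact hT
      | succ n hn ih => rw [codim_succ φ U n (by omega), ih, add_top]
    refine ⟨⊤, tendsto_const_nhds.congr' ?_⟩
    filter_upwards [eventually_ge_atTop N] with n hn
    rw [hall n hn, ENat.toENNReal_top, ENNReal.top_div_of_ne_top (ENNReal.natCast_ne_top n)]
  · push Not at h
    obtain ⟨N₀, hN₀⟩ := WellFoundedGT.monotone_chain_condition
      (⟨fun n => OrderDual.toDual (incr φ U n), fun a b hab => incr_antitone φ U hab⟩ :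
        ℕ →o (ℕ∞)ᵒᵈ)
    have hconst : ∀ m, N₀ ≤ m → incr φ U m = incr φ U N₀ := fun m hm =>
      (OrderDual.toDual.injective (hN₀ m hm)).symm
    obtain ⟨A, hA⟩ := ENat.ne_top_iff_exists.1 (h (N₀ + 1) (by omega))
    have hd : incr φ U N₀ ≠ ⊤ := by
      intro hd
      refine h (N₀ + 1 + 1) (by omega) ?_
      rw [codim_succ φ U _ (by omega), hconst _ (by omega), hd, top_add]
    obtain ⟨d, hd⟩ := ENat.ne_top_iff_exists.1 hd
    have hall : ∀ m, codimCotraj φ U (m + (N₀ + 1)) = ((A + m * d : ℕ) : ℕ∞) := by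
      intro m
      induction m with
      | zero => simpa using hA.symm
      | succ m ih =>
        rw [show m + 1 + (N₀ + 1) = m + (N₀ + 1) + 1 by omega, codim_succ φ U _ (by omega), ih,
          hconst _ (by omega), ← hd]
        push_cast
        ring
    refine ⟨(d : ℝ≥0∞), ?_⟩
    rw [← tendsto_add_atTop_iff_nat (N₀ + 1)]
    have hreal : Tendsto (fun m : ℕ => (((A : ℝ) + d * m) / (((N₀ + 1 : ℕ) : ℝ) + 1 * m)))
        atTop (𝓝 ((d : ℝ) / 1)) :=
      tendsto_add_mul_div_add_mul_atTop_nhds (A : ℝ) ((N₀ + 1 : ℕ) : ℝ) (d : ℝ) one_ne_zero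
    have := ENNReal.tendsto_ofReal hreal
    rw [div_one, ENNReal.ofReal_natCast] at this
    refine this.congr fun m => ?_
    rw [hall m, ENNReal.ofReal_div_of_pos (by positivity)]
    congr 1
    · rw [show (A : ℝ) + d * m = ((A + m * d : ℕ) : ℝ) by push_cast; ring,
        ENNReal.ofReal_natCast]
      simp
    · rw [show ((N₀ + 1 : ℕ) : ℝ) + 1 * m = ((m + (N₀ + 1) : ℕ) : ℝ) by push_cast; ring,
        ENNReal.ofReal_natCast]

end Cotrajectory

section Flow

variable {K V : Type*} [Field K] [AddCommGroup V] [Module K V] [TopologicalSpace V]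

/-- The topological entropy `ent*(V, φ) = sup {H*(φ, U) | U ∈ 𝓑(V)}`. -/
noncomputable def topEntropy (φ : V →L[K] V) : ℝ≥0∞ :=
  ⨆ U ∈ openLC K V, entropyAt (φ : V →ₗ[K] V) U

/-- The restriction `φ↾_C : C → C` to the intersection `C` of a family of cotrajectories
(with `C = V` for the empty family). -/
noncomputable def restrictCotraj {ι : Sort*} (φ : V →L[K] V) (U : ι → Submodule K V) :
    (⨅ i, cotraj (φ : V →ₗ[K] V) (U i) : Submodule K V) →L[K]
      (⨅ i, cotraj (φ : V →ₗ[K] V) (U i) : Submodule K V) :=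
  φ.restrict (map_mem_iInf_cotraj (φ : V →ₗ[K] V) U)

/-- `C(φ, U)` is a non-stationary cocyclic cotrajectory: `U` is a linearly compact open
subspace of codimension `1`, and `C(φ, U)` is not open in `V`. -/
structure IsNonstationaryCocyclic (φ : V →L[K] V) (U : Submodule K V) : Prop where
  mem_openLC : U ∈ openLC K V
  cocyclic : Module.finrank K (V ⧸ U) = 1
  nonstationary : ¬ IsOpen (cotraj (φ : V →ₗ[K] V) U : Set V)

end Flow

section Coindependent

variable {R M : Type*} [Ring R] [AddCommGroup M] [Module R M]

/-- A family `N` of proper submodules of `M` is coindependent if, for every finite set `s` of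
indices, `N i + ⋂_{j ∈ s, j ≠ i} N j = M` for all `i ∈ s`. -/
def Coindependent {ι : Type*} (N : ι → Submodule R M) : Prop :=
  (∀ i, N i ≠ ⊤) ∧
    ∀ s : Finset ι, ∀ i ∈ s, N i ⊔ (⨅ (j : ι) (_ : j ∈ s ∧ j ≠ i), N j) = ⊤

/-- For a finite index set it is enough to consider the whole family. -/
theorem coindependent_iff_of_finite {ι : Type*} [Finite ι] (N : ι → Submodule R M) :
    Coindependent N ↔
      (∀ i, N i ≠ ⊤) ∧ ∀ i, N i ⊔ (⨅ (j : ι) (_ : j ≠ i), N j) = ⊤ := by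
  have := Fintype.ofFinite ι
  refine and_congr_right fun _ => ⟨fun h i => by simpa using h Finset.univ i (by simp), ?_⟩
  intro h s i _
  refine top_le_iff.1 ((h i).symm.le.trans (sup_le_sup_left ?_ _))
  exact le_iInf₂ fun j hj => iInf₂_le j hj.2

/-- The members of a coindependent family are pairwise distinct, so that a coindependent family
is the same thing as an indexed coindependent set. -/
theorem Coindependent.injective {ι : Type*} {N : ι → Submodule R M} (h : Coindependent N) :
    Function.Injective N := by
  classical
  intro i j hij
  by_contra hne
  have h1 := h.2 {i, j} i (by simp)
  have h2 : (⨅ (l : ι) (_ : l ∈ ({i, j} : Finset ι) ∧ l ≠ i), N l) ≤ N i :=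
    (iInf₂_le j ⟨by simp, Ne.symm hne⟩).trans hij.ge
  rw [sup_eq_left.2 h2] at h1
  exact h.1 i h1

end Coindependent

end TopFlow

/-! The proof is Lefschetz duality. The continuous dual of `V` is a `K[X]`-module on which `X` acts
by precomposition with `φ`, and `ent*(V, φ)` is its rank (`IsLinearlyCompact.topEntropy_eq_rank`).

The cotrajectories translate as follows. An open subspace of codimension one is the kernel of a form
`w`, and its cotrajectory is the annihilator in `V` of the cyclic module `K[X] w`. It is
non-stationary exactly when `w` has zero annihilator in `K[X]`
(`IsLinearlyCompact.isOpen_cotraj_kerForm_iff`), and such cotrajectories are coindependent exactly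
when the `w i` are linearly independent over `K[X]` (`IsLinearlyCompact.coindependent_cotraj_iff`).
The dual of their intersection `C` is the quotient of the dual of `V` by the span of the `w i`, so
zero entropy on `C` means that this quotient is torsion.

The theorem thus becomes a fact about modules over a domain: the rank is `k` iff `k` independent
elements exist whose span has torsion quotient, and it is infinite iff an infinite independent
sequence exists. -/

namespace TopFlow

/-! ### Linear compactness and continuous linear forms -/

section LinearForms

variable {K V : Type*} [Field K] [AddCommGroup V] [Module K V]

/-- Row rank equals column rank: independence of the forms makes the vectors `(f i x)ᵢ` span `ι →
K`, and these vectors already form a subspace. -/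
theorem exists_forall_linearForm_eq {ι : Type*} [Finite ι] {f : ι → V →ₗ[K] K}
    (hf : LinearIndependent K f) (c : ι → K) : ∃ x, ∀ i, f i x = c i := by
  have h1 : LinearIndependent K (fun i => (f i : V → K)) :=
    hf.map' (LinearMap.ltoFun K V K K) (LinearMap.ker_eq_bot.2 DFunLike.coe_injective)
  have h2 := span_flip_eq_top_iff_linearIndependent.2 h1
  have h3 : Submodule.span K (Set.range (flip fun i => (f i : V → K))) ≤
      LinearMap.range (LinearMap.pi f) := by
    rw [Submodule.span_le]
    rintro _ ⟨x, rfl⟩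
    exact ⟨x, rfl⟩
  obtain ⟨x, hx⟩ := (h2.ge.trans h3) (Submodule.mem_top (x := c))
  exact ⟨x, fun i => congrFun hx i⟩

theorem isLinearVariety_fiber (f : V →ₗ[K] K) (v : V) : IsLinearVariety K {x | f x = f v} := by
  refine ⟨v, LinearMap.ker f, ?_⟩
  ext x
  simp only [Set.mem_ofPred_eq, Set.mem_image, SetLike.mem_coe, LinearMap.mem_ker]
  constructor
  · intro h
    exact ⟨x - v, by simp [h], by abel⟩
  · rintro ⟨w, hw, rfl⟩
    simp [hw]

variable [TopologicalSpace V]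

theorem IsLinearlyCompact.iInter_nonempty (hV : IsLinearlyCompact K V) {ι : Type*}
    (A : ι → Set V) (hA : ∀ i, IsClosed (A i) ∧ IsLinearVariety K (A i))
    (h : ∀ s : Finset ι, (⋂ i ∈ s, A i).Nonempty) : (⋂ i, A i).Nonempty := by
  classical
  have := hV.sInter_nonempty (Set.range A) (by rintro _ ⟨i, rfl⟩; exact hA i) ?_
  · simpa using this
  · intro T hT
    rw [← Set.image_univ, Finset.subset_set_image_iff] at hT
    obtain ⟨s, -, rfl⟩ := hT
    simpa using h s

theorem isOpen_submodule_of_le [IsTopologicalAddGroup V] {U W : Submodule K V} (hU : IsOpen (U : Set V)) (h : U ≤ W) :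
    IsOpen (W : Set V) :=
  W.toAddSubgroup.isOpen_of_mem_nhds (mem_of_superset (hU.mem_nhds U.zero_mem) h)

theorem isClosed_submodule_of_isOpen [IsTopologicalAddGroup V]
    {U : Submodule K V} (hU : IsOpen (U : Set V)) :
    IsClosed (U : Set V) :=
  U.toAddSubgroup.isClosed_of_isOpen hU

theorem IsLinearlyCompact.of_isClosed (hV : IsLinearlyCompact K V) {C : Submodule K V}
    (hC : IsClosed (C : Set V)) : IsLinearlyCompact K C where
  t2 := by
    have := hV.t2
    infer_instance
  linearTopology := by
    have := hV.linearTopology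
    refine IsLinearTopology.mk_of_hasBasis K (p := fun N : Submodule K V => (N : Set V) ∈ 𝓝 0)
      (s := fun N => N.comap C.subtype) ?_
    rw [nhds_subtype_eq_comap]
    exact (IsLinearTopology.hasBasis_submodule K).comap _
  sInter_nonempty := by
    intro S hS hfin
    have := hV.iInter_nonempty (fun A : S => (Subtype.val '' (A : Set C) : Set V)) ?_ ?_
    · obtain ⟨x, hx⟩ := this
      -- The common point `x` is only known to lie in `C` once some member of `S` contains it.
      obtain hempty | ⟨A₀, hA₀⟩ := S.eq_empty_or_nonempty
      · simp [hempty]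
      · rw [Set.mem_iInter] at hx
        obtain ⟨y, hy, rfl⟩ := hx ⟨A₀, hA₀⟩
        refine ⟨y, fun A hA => ?_⟩
        obtain ⟨z, hz, hzy⟩ := hx ⟨A, hA⟩
        rwa [← Subtype.val_injective hzy]
    · rintro ⟨A, hA⟩
      refine ⟨hC.isClosedEmbedding_subtypeVal.isClosedMap _ (hS A hA).1, ?_⟩
      obtain ⟨v, W, hW⟩ := (hS A hA).2
      refine ⟨v, W.map C.subtype, ?_⟩
      change Subtype.val '' A = _
      rw [Submodule.map_coe, hW, Set.image_image, Set.image_image]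
      rfl
    · intro s
      obtain ⟨y, hy⟩ := hfin (s.map (Function.Embedding.subtype _)) (by simp)
      refine ⟨y, Set.mem_iInter₂.2 fun A hA => ⟨y, hy A ?_, rfl⟩⟩
      simpa using hA

/-- Open subspaces are closed, and closed subspaces inherit linear compactness, so that condition in
`𝓑(V)` is automatic. -/
theorem IsLinearlyCompact.mem_openLC_iff [IsTopologicalAddGroup V]
    (hV : IsLinearlyCompact K V) {U : Submodule K V} : U ∈ openLC K V ↔ IsOpen (U : Set V) :=
  ⟨fun h => h.1, fun h => ⟨h, hV.of_isClosed (isClosed_submodule_of_isOpen h)⟩⟩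

variable [TopologicalSpace K] [DiscreteTopology K]

/-- Linear compactness in the form used for duality: the solution set of each equation is a closed
linear variety, closed because `K` is discrete. -/
theorem IsLinearlyCompact.exists_forall_eq (hV : IsLinearlyCompact K V) {ι : Type*}
    (f : ι → V →L[K] K) (c : ι → K) (h : ∀ s : Finset ι, ∃ x, ∀ i ∈ s, f i x = c i) :
    ∃ x, ∀ i, f i x = c i := by
  have := hV.iInter_nonempty (fun i => {x | f i x = c i}) (fun i => ⟨?_, ?_⟩) ?_
  · obtain ⟨x, hx⟩ := this
    exact ⟨x, fun i => Set.mem_iInter.1 hx i⟩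
  · exact (isClosed_discrete {c i}).preimage (f i).continuous
  · obtain ⟨x, hx⟩ := h {i}
    have := isLinearVariety_fiber (f i : V →ₗ[K] K) x
    rwa [ContinuousLinearMap.coe_coe, hx i (by simp)] at this
  · intro s
    obtain ⟨x, hx⟩ := h s
    exact ⟨x, by simpa using hx⟩

/-- A linearly independent family of continuous linear forms takes arbitrary values. -/
theorem IsLinearlyCompact.exists_forall_eq_of_linearIndependent (hV : IsLinearlyCompact K V)
    {ι : Type*} {f : ι → V →L[K] K} (hf : LinearIndependent K f) (c : ι → K) :
    ∃ x, ∀ i, f i x = c i := by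
  refine hV.exists_forall_eq f c fun s => ?_
  have h1 : LinearIndependent K (fun i : s => (f i : V →ₗ[K] K)) :=
    (hf.comp _ Subtype.val_injective).map' (ContinuousLinearMap.coeLM K)
      (LinearMap.ker_eq_bot.2 ContinuousLinearMap.coe_injective)
  obtain ⟨x, hx⟩ := exists_forall_linearForm_eq h1 (fun i => c i)
  exact ⟨x, fun i hi => hx ⟨i, hi⟩⟩

/-- A continuous linear form vanishing on the common kernel of a family of continuous linear
forms lies in their span. -/
theorem IsLinearlyCompact.mem_span_range (hV : IsLinearlyCompact K V)
    {ι : Type*} (f : ι → V →L[K] K) (g : V →L[K] K) (h : ∀ x, (∀ i, f i x = 0) → g x = 0) :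
    g ∈ Submodule.span K (Set.range f) := by
  classical
  have key : ∃ s : Finset ι, ∀ x, (∀ i ∈ s, f i x = 0) → g x = 0 := by
    by_contra hcon
    push Not at hcon
    -- If no finite subfamily sufficed, the system `f i = 0` for all `i`, `g = 1` would be finitely
    -- solvable, hence solvable.
    obtain ⟨x, hx⟩ := hV.exists_forall_eq (fun i : Option ι => i.elim g f)
      (fun i => i.elim 1 fun _ => 0) (fun s => by
        obtain ⟨x, hx, hgx⟩ := hcon (Finset.eraseNone s)
        refine ⟨(g x)⁻¹ • x, ?_⟩
        rintro (_ | i) hi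
        · simp [hgx]
        · simp [hx i (by simpa using hi)])
    have h1 := h x fun i => hx (some i)
    exact one_ne_zero ((hx none).symm.trans h1)
  obtain ⟨s, hs⟩ := key
  have h1 : (g : V →ₗ[K] K) ∈
      Submodule.span K (Set.range fun i : s => (f i : V →ₗ[K] K)) := by
    refine mem_span_of_iInf_ker_le_ker fun x hx => ?_
    simp only [Submodule.mem_iInf, LinearMap.mem_ker, ContinuousLinearMap.coe_coe] at hx ⊢
    exact hs x fun i hi => hx ⟨i, hi⟩
  have h2 : (g : V →ₗ[K] K) ∈
      (Submodule.span K (Set.range f)).map (ContinuousLinearMap.coeLM K) := by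
    rw [Submodule.map_span]
    refine Submodule.span_mono ?_ h1
    rintro _ ⟨i, rfl⟩
    exact ⟨f i, ⟨i, rfl⟩, rfl⟩
  obtain ⟨g', hg', hgg⟩ := h2
  rwa [ContinuousLinearMap.coe_injective hgg] at hg'

variable [IsTopologicalAddGroup V]

/-- A linear form vanishing on an open subspace is continuous. -/
def linearFormOfOpen {U : Submodule K V} (hU : IsOpen (U : Set V)) (f : V →ₗ[K] K)
    (h : U ≤ LinearMap.ker f) : V →L[K] K where
  toLinearMap := f
  cont := by
    refine continuous_of_continuousAt_zero f ?_
    refine (tendsto_const_nhds (x := f 0)).congr' ?_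
    filter_upwards [hU.mem_nhds U.zero_mem] with x hx
    rw [map_zero, LinearMap.mem_ker.1 (h hx)]

@[simp]
theorem linearFormOfOpen_apply {U : Submodule K V} (hU : IsOpen (U : Set V)) (f : V →ₗ[K] K)
    (h : U ≤ LinearMap.ker f) (x : V) : linearFormOfOpen hU f h x = f x :=
  rfl

/-- An open subspace of a linearly compact space has finite codimension. -/
theorem IsLinearlyCompact.finite_quotient (hV : IsLinearlyCompact K V) {U : Submodule K V}
    (hU : IsOpen (U : Set V)) : Module.Finite K (V ⧸ U) := by
  let b := Module.Basis.ofVectorSpace K (V ⧸ U)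
  have hker : ∀ i, U ≤ LinearMap.ker ((b.coord i).comp U.mkQ) := by
    intro i x hx
    simp [(Submodule.Quotient.mk_eq_zero U).2 hx]
  -- Compactness yields a vector all of whose coordinates are `1`; since coordinates have finite
  -- support, the basis is finite.
  obtain ⟨x, hx⟩ := hV.exists_forall_eq (fun i => linearFormOfOpen hU _ (hker i)) (fun _ => 1)
    (fun s => by
      obtain ⟨x, hx⟩ := U.mkQ_surjective (∑ i ∈ s, b i)
      refine ⟨x, fun i hi => ?_⟩
      simp only [linearFormOfOpen_apply, LinearMap.comp_apply, hx, map_sum, Module.Basis.coord_apply,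
        Module.Basis.repr_self]
      rw [Finset.sum_eq_single_of_mem i hi]
      · simp
      · intro j _ hj
        simp [hj])
  have : Finite (Module.Basis.ofVectorSpaceIndex K (V ⧸ U)) := by
    refine Finite.of_injective (β := (b.repr (U.mkQ x)).support) (fun i => ⟨i, ?_⟩) ?_
    · rw [Finsupp.mem_support_iff]
      exact (hx i).trans_ne one_ne_zero
    · intro i j hij
      exact Subtype.ext_iff.1 hij
  exact Module.Finite.of_basis b

/-- An open subspace is the common kernel of finitely many continuous linear forms. -/
theorem IsLinearlyCompact.exists_forms (hV : IsLinearlyCompact K V) {U : Submodule K V}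
    (hU : IsOpen (U : Set V)) :
    ∃ f : Fin (Module.finrank K (V ⧸ U)) → V →L[K] K, ∀ x, x ∈ U ↔ ∀ i, f i x = 0 := by
  have := hV.finite_quotient hU
  let b := Module.finBasis K (V ⧸ U)
  have hker : ∀ i, U ≤ LinearMap.ker ((b.coord i).comp U.mkQ) := by
    intro i x hx
    simp [(Submodule.Quotient.mk_eq_zero U).2 hx]
  refine ⟨fun i => linearFormOfOpen hU _ (hker i), fun x => ?_⟩
  rw [← Submodule.Quotient.mk_eq_zero, ← b.forall_coord_eq_zero_iff]
  rfl

/-- Continuous linear forms extend from subspaces. -/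
theorem IsLinearlyCompact.exists_extension (hV : IsLinearlyCompact K V) (C : Submodule K V)
    (f : C →L[K] K) : ∃ g : V →L[K] K, ∀ x : C, g x = f x := by
  have := hV.linearTopology
  have hker : (LinearMap.ker (f : C →ₗ[K] K) : Set C) ∈ 𝓝 0 :=
    ((isOpen_discrete {0}).preimage f.continuous).mem_nhds (by simp)
  rw [nhds_subtype_eq_comap, ZeroMemClass.coe_zero, ((IsLinearTopology.hasBasis_open_submodule K).comap _).mem_iff] at hker
  obtain ⟨O, hO, hOf⟩ := hker
  -- The kernel of `f` contains `C ∩ O` for an open subspace `O`, so `f` descends to the image of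
  -- `C` in `V ⧸ O`, where extension is pure linear algebra.
  let q : C →ₗ[K] V ⧸ O := O.mkQ.comp C.subtype
  have hq : LinearMap.ker q ≤ LinearMap.ker (f : C →ₗ[K] K) := by
    intro x hx
    refine hOf ?_
    simpa [q] using hx
  obtain ⟨g, hg⟩ := (((LinearMap.ker q).liftQ _ hq).comp
    q.quotKerEquivRange.symm.toLinearMap).exists_extend
  refine ⟨linearFormOfOpen hO (g.comp O.mkQ) ?_, fun x => ?_⟩
  · intro x hx
    simp [(Submodule.Quotient.mk_eq_zero O).2 hx]
  · have h1 := LinearMap.congr_fun hg (q.quotKerEquivRange (Submodule.Quotient.mk x))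
    rw [LinearMap.comp_apply, LinearMap.comp_apply] at h1
    simp only [LinearEquiv.coe_coe, LinearEquiv.symm_apply_apply] at h1
    exact h1

end LinearForms

/-! ### Rank over a domain -/

section Rank

open Cardinal

variable {R M : Type*} [CommRing R] [IsDomain R] [AddCommGroup M] [Module R M]

/-- Rank is additive over a domain, so rank `k` means that the quotient by the span of `b` has rank
zero, that is, is torsion. -/
theorem rank_eq_iff_of_linearIndependent {k : ℕ} {b : Fin k → M} (hb : LinearIndependent R b) :
    Module.rank R M = k ↔ ∀ x : M, ∃ p : R, p ≠ 0 ∧ p • x ∈ Submodule.span R (Set.range b) := by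
  have h1 := rank_quotient_add_rank_of_isDomain (Submodule.span R (Set.range b))
  have h2 : Module.rank R (Submodule.span R (Set.range b)) = k := by
    have := mk_range_eq_of_injective hb.injective
    rw [rank_span hb]
    simpa using this
  rw [h2] at h1
  have h3 : (Module.rank R M = k) ↔ Module.rank R (M ⧸ Submodule.span R (Set.range b)) = 0 := by
    rw [← h1]
    constructor
    · intro h
      exact Cardinal.eq_of_add_eq_add_right (by rwa [zero_add]) (natCast_lt_aleph0 (n := k))
    · intro h
      rw [h, zero_add]
  rw [h3, rank_eq_zero_iff, (Submodule.Quotient.mk_surjective _).forall]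
  simp only [← Submodule.Quotient.mk_smul, Submodule.Quotient.mk_eq_zero]

end Rank

/-! ### Bounding entropy by counting linear conditions -/

section Codimension

variable {K V : Type*} [Field K] [AddCommGroup V] [Module K V]

theorem codimCotraj_le (φ : V →ₗ[K] V) (U : Submodule K V) (n : ℕ) {ι : Type*} [Fintype ι]
    (t : ι → V →ₗ[K] K) (h : ∀ x, (∀ i, t i x = 0) → x ∈ partialCotraj φ U n) :
    codimCotraj φ U n ≤ Fintype.card ι := by
  rw [codimCotraj, ← Module.length_eq_rank]
  let q : U →ₗ[K] ι → K := (LinearMap.pi t).comp U.subtype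
  have hq : LinearMap.ker q ≤ (partialCotraj φ U n).submoduleOf U :=
    fun x hx => h x fun i => congrFun hx i
  refine (Module.length_le_of_surjective _ (Submodule.factor_surjective hq)).trans ?_
  refine (Module.length_le_of_injective ((LinearMap.ker q).liftQ q le_rfl) ?_).trans ?_
  · exact LinearMap.ker_eq_bot.1 (Submodule.ker_liftQ_eq_bot' _ _ rfl)
  · simp [Module.length_eq_rank]

theorem le_codimCotraj (φ : V →ₗ[K] V) (U : Submodule K V) (n : ℕ) {ι : Type*} [Fintype ι]
    (t : ι → V →ₗ[K] K) (hs : ∀ c : ι → K, ∃ x ∈ U, ∀ i, t i x = c i)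
    (h : ∀ x ∈ partialCotraj φ U n, ∀ i, t i x = 0) :
    (Fintype.card ι : ℕ∞) ≤ codimCotraj φ U n := by
  rw [codimCotraj, ← Module.length_eq_rank]
  let q : U →ₗ[K] ι → K := (LinearMap.pi t).comp U.subtype
  have hq : (partialCotraj φ U n).submoduleOf U ≤ LinearMap.ker q :=
    fun x hx => funext fun i => h x hx i
  refine le_trans ?_ (Module.length_le_of_surjective (Submodule.liftQ _ q hq) ?_)
  · simp [Module.length_eq_rank]
  · intro c
    obtain ⟨x, hx, hxc⟩ := hs c
    exact ⟨Submodule.Quotient.mk ⟨x, hx⟩, funext hxc⟩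

theorem tendsto_add_natCast_div (a : ℝ≥0∞) (B : ℕ) :
    Tendsto (fun n : ℕ => a + (B : ℝ≥0∞) / n) atTop (𝓝 a) := by
  have h1 : Tendsto (fun n : ℕ => (B : ℝ≥0∞) * (n : ℝ≥0∞)⁻¹) atTop (𝓝 (B * 0)) :=
    ENNReal.Tendsto.const_mul ENNReal.tendsto_inv_nat_nhds_zero
      (Or.inr (ENNReal.natCast_ne_top B))
  simpa [div_eq_mul_inv] using tendsto_const_nhds.add h1

/-- The bounded error `B` disappears after division by `n`. -/
theorem entropyAt_le {φ : V →ₗ[K] V} {U : Submodule K V} {r B : ℕ}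
    (h : ∀ n, codimCotraj φ U n ≤ ((r * n + B : ℕ) : ℕ∞)) : entropyAt φ U ≤ r := by
  refine le_of_tendsto_of_tendsto (tendsto_entropyAt φ U) (tendsto_add_natCast_div r B) ?_
  filter_upwards [eventually_gt_atTop 0] with n hn
  have h1 : (codimCotraj φ U n : ℝ≥0∞) ≤ r * n + B := by
    have := ENat.toENNReal_mono (h n)
    simpa using this
  refine (ENNReal.div_le_div_right h1 _).trans ?_
  rw [ENNReal.add_div, ENNReal.mul_div_cancel_right (by simpa using hn.ne')
    (ENNReal.natCast_ne_top n)]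

theorem le_entropyAt {φ : V →ₗ[K] V} {U : Submodule K V} {r B : ℕ}
    (h : ∀ n, ((r * n : ℕ) : ℕ∞) ≤ codimCotraj φ U n + B) : (r : ℝ≥0∞) ≤ entropyAt φ U := by
  have h2 : Tendsto (fun n : ℕ => (codimCotraj φ U n : ℝ≥0∞) / n + (B : ℝ≥0∞) / n) atTop
      (𝓝 (entropyAt φ U)) := by
    simpa using (tendsto_entropyAt φ U).add (tendsto_add_natCast_div 0 B)
  refine ge_of_tendsto h2 ?_
  filter_upwards [eventually_gt_atTop 0] with n hn
  have h1 : (r * n : ℝ≥0∞) ≤ codimCotraj φ U n + B := by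
    have := ENat.toENNReal_mono (h n)
    simpa using this
  rw [← ENNReal.add_div]
  refine le_trans ?_ (ENNReal.div_le_div_right h1 _)
  rw [ENNReal.mul_div_cancel_right (by simpa using hn.ne') (ENNReal.natCast_ne_top n)]

end Codimension

/-! ### The dual `K[X]`-module and its rank -/

section DualModule

open Polynomial

variable {K V : Type*} [Field K] [TopologicalSpace K] [DiscreteTopology K]
  [AddCommGroup V] [Module K V] [TopologicalSpace V]

/-- The endomorphism of the continuous dual induced by `φ`. -/
def dualEnd (φ : V →L[K] V) : Module.End K (V →L[K] K) where
  toFun f := f.comp φ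
  map_add' _ _ := rfl
  map_smul' _ _ := rfl

/-- The continuous dual of `V`, as a `K[X]`-module on which `X` acts by precomposition
with `φ`. -/
def DualModule (φ : V →L[K] V) : Type _ :=
  Module.AEval' (dualEnd φ)

noncomputable instance (φ : V →L[K] V) : AddCommGroup (DualModule φ) :=
  inferInstanceAs (AddCommGroup (Module.AEval' (dualEnd φ)))

noncomputable instance (φ : V →L[K] V) : Module K (DualModule φ) :=
  inferInstanceAs (Module K (Module.AEval' (dualEnd φ)))

noncomputable instance (φ : V →L[K] V) : Module K[X] (DualModule φ) :=
  inferInstanceAs (Module K[X] (Module.AEval' (dualEnd φ)))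

instance (φ : V →L[K] V) : IsScalarTower K K[X] (DualModule φ) :=
  inferInstanceAs (IsScalarTower K K[X] (Module.AEval' (dualEnd φ)))

/-- The linear form underlying an element of the dual module. -/
noncomputable def form (φ : V →L[K] V) : DualModule φ ≃ₗ[K] (V →L[K] K) :=
  (Module.AEval'.of (dualEnd φ)).symm

variable {φ : V →L[K] V}

theorem form_X_smul (w : DualModule φ) (x : V) :
    form φ ((X : K[X]) • w) x = form φ w (φ x) :=
  DFunLike.congr_fun (Module.AEval'.of_symm_X_smul (dualEnd φ) w) x

theorem form_X_pow_smul (n : ℕ) (w : DualModule φ) (x : V) :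
    form φ ((X : K[X]) ^ n • w) x = form φ w (((φ : V →ₗ[K] V) ^ n) x) := by
  induction n generalizing x with
  | zero => simp
  | succ n ih =>
    rw [pow_succ', mul_smul, form_X_smul, ih, pow_succ, Module.End.mul_apply,
      ContinuousLinearMap.coe_coe]

theorem C_smul_dualModule (a : K) (w : DualModule φ) : (C a : K[X]) • w = a • w :=
  Module.AEval.C_smul (M := V →L[K] K) (dualEnd φ) a w

theorem form_smul (p : K[X]) (w : DualModule φ) (x : V) :
    form φ (p • w) x = p.sum fun n a => a * form φ w (((φ : V →ₗ[K] V) ^ n) x) := by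
  conv_lhs => rw [p.as_sum_support_C_mul_X_pow]
  simp only [Finset.sum_smul, map_sum, Polynomial.sum, sum_apply, mul_smul,
    C_smul_dualModule, map_smul, smul_apply, smul_eq_mul, form_X_pow_smul]

theorem form_smul_eq_zero_of_degree_lt {p : K[X]} {w : DualModule φ} {x : V} {N : ℕ}
    (h : ∀ n < N, form φ ((X : K[X]) ^ n • w) x = 0) (hp : p.degree < N) :
    form φ (p • w) x = 0 := by
  rw [form_smul]
  refine Finset.sum_eq_zero fun n hn => ?_
  beta_reduce
  rw [← form_X_pow_smul, h n, mul_zero]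
  exact_mod_cast (le_degree_of_ne_zero (mem_support_iff.1 hn)).trans_lt hp

/-- The kernel of the linear form underlying an element of the dual module. -/
noncomputable def kerForm (w : DualModule φ) : Submodule K V :=
  LinearMap.ker (form φ w : V →ₗ[K] K)

@[simp]
theorem mem_kerForm {w : DualModule φ} {x : V} : x ∈ kerForm w ↔ form φ w x = 0 :=
  Iff.rfl

theorem isOpen_kerForm (w : DualModule φ) : IsOpen (kerForm w : Set V) :=
  (isOpen_discrete {0}).preimage (form φ w).continuous

theorem mem_cotraj_kerForm {w : DualModule φ} {x : V} :
    x ∈ cotraj (φ : V →ₗ[K] V) (kerForm w) ↔ ∀ n : ℕ, form φ ((X : K[X]) ^ n • w) x = 0 := by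
  simp only [mem_cotraj, mem_kerForm, form_X_pow_smul]

theorem form_smul_eq_zero_of_mem_cotraj {w : DualModule φ} {x : V}
    (h : x ∈ cotraj (φ : V →ₗ[K] V) (kerForm w)) (p : K[X]) : form φ (p • w) x = 0 :=
  form_smul_eq_zero_of_degree_lt (N := p.natDegree + 1) (fun n _ => mem_cotraj_kerForm.1 h n)
    (degree_le_natDegree.trans_lt (by exact_mod_cast Nat.lt_succ_self _))

theorem linearIndependent_X_pow_smul {ι : Type*} {w : ι → DualModule φ}
    (hw : LinearIndependent K[X] w) :
    LinearIndependent K fun q : ℕ × ι => form φ ((X : K[X]) ^ q.1 • w q.2) := by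
  have h1 : LinearIndependent K fun n : ℕ => (X : K[X]) ^ n := by
    simpa only [Polynomial.coe_basisMonomials, ← Polynomial.X_pow_eq_monomial] using
      (Polynomial.basisMonomials K).linearIndependent
  have h2 := linearIndependent_smul h1 hw
  have h3 := h2.map_injOn (form φ : DualModule φ →ₗ[K] (V →L[K] K)) (form φ).injective.injOn
  exact h3

/-- Take `U = ⋂ⱼ ker wⱼ`. Then `Cₙ` is cut out by the forms `Xⁱ wⱼ` with `i < n`. They are
independent over `K`, and those with `i > 0` stay independent on `U`, so the codimension grows by
`r` per step. -/
theorem IsLinearlyCompact.le_topEntropy [IsTopologicalAddGroup V] (hV : IsLinearlyCompact K V)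
    {r : ℕ} {w : Fin r → DualModule φ} (hw : LinearIndependent K[X] w) :
    (r : ℝ≥0∞) ≤ topEntropy φ := by
  have hopen : IsOpen ((⨅ j, kerForm (w j) : Submodule K V) : Set V) := by
    rw [Submodule.coe_iInf]
    exact isOpen_iInter_of_finite fun j => isOpen_kerForm _
  refine le_trans ?_ (le_iSup₂ (f := fun U (_ : U ∈ openLC K V) => entropyAt (φ : V →ₗ[K] V) U)
    (⨅ j, kerForm (w j)) (hV.mem_openLC_iff.2 hopen))
  -- The conditions with `i = 0` hold on `U` already; their number `r` is the error term.
  refine le_entropyAt (B := r) fun n => ?_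
  rcases n with _ | n
  · simp
  have h := le_codimCotraj (φ : V →ₗ[K] V) (⨅ j, kerForm (w j)) (n + 1)
    (fun q : Fin n × Fin r => (form φ ((X : K[X]) ^ ((q.1 : ℕ) + 1) • w q.2) : V →ₗ[K] K)) ?_ ?_
  · refine le_trans ?_ (add_le_add_left h _)
    simp only [Fintype.card_prod, Fintype.card_fin]
    norm_cast
    exact (by ring : r * (n + 1) = n * r + r).le
  · intro c
    obtain ⟨x, hx⟩ := hV.exists_forall_eq_of_linearIndependent (linearIndependent_X_pow_smul hw)
      -- The value `0` at exponent `0` puts `x` in `U`; the values beyond exponent `n` are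
      -- irrelevant.
      (fun q => if h : 0 < q.1 ∧ q.1 - 1 < n then c (⟨q.1 - 1, h.2⟩, q.2) else 0)
    refine ⟨x, ?_, fun q => ?_⟩
    · simp only [Submodule.mem_iInf, mem_kerForm]
      intro j
      simpa using hx (0, j)
    · simpa using hx (q.1 + 1, q.2)
  · intro x hx q
    have h1 := mem_partialCotraj.1 hx (q.1 + 1) (by omega)
    simp only [Submodule.mem_iInf, mem_kerForm] at h1
    rw [ContinuousLinearMap.coe_coe, form_X_pow_smul]
    exact h1 q.2

/-- If `U` is cut out by forms `f a` and `p a • f a = ∑ⱼ q a j • b j`, dividing `Xⁱ` by `p a`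
expresses `Xⁱ f a` through boundedly many `Xˢ f a` and through `Xˢ bⱼ` with `s < n + c`: about `r n`
conditions suffice for `Cₙ`. -/
theorem IsLinearlyCompact.topEntropy_le [IsTopologicalAddGroup V] (hV : IsLinearlyCompact K V)
    {r : ℕ} {b : Fin r → DualModule φ}
    (hb : ∀ w : DualModule φ, ∃ p : K[X], p ≠ 0 ∧ p • w ∈ Submodule.span K[X] (Set.range b)) :
    topEntropy φ ≤ r := by
  refine iSup₂_le fun U hU => ?_
  obtain ⟨f, hf⟩ := hV.exists_forms hU.1
  generalize Module.finrank K (V ⧸ U) = m at f hf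
  have hb' : ∀ a, ∃ p : K[X], p ≠ 0 ∧ ∃ q : Fin r → K[X],
      ∑ j, q j • b j = p • (form φ).symm (f a) := fun a => by
    obtain ⟨p, hp, h⟩ := hb ((form φ).symm (f a))
    exact ⟨p, hp, (Submodule.mem_span_range_iff_exists_fun _).1 h⟩
  choose p hp q hq using hb'
  -- `D` bounds the degrees of the remainders modulo `p a`, and `c` the degrees added by the
  -- coefficients `q a j`.
  let D := Finset.univ.sup fun a => (p a).natDegree
  let c := Finset.univ.sup fun a => Finset.univ.sup fun j => (q a j).natDegree
  refine entropyAt_le (B := c * r + D * m) fun n => ?_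
  refine (codimCotraj_le (ι := (Fin (n + c) × Fin r) ⊕ (Fin D × Fin m)) _ U n
    (Sum.elim (fun s => (form φ ((X : K[X]) ^ (s.1 : ℕ) • b s.2) : V →ₗ[K] K))
      (fun s => (form φ ((X : K[X]) ^ (s.1 : ℕ) • (form φ).symm (f s.2)) : V →ₗ[K] K))) ?_).trans ?_
  · intro x hx
    have hx1 : ∀ s < n + c, ∀ j, form φ ((X : K[X]) ^ s • b j) x = 0 :=
      fun s hs j => hx (Sum.inl (⟨s, hs⟩, j))
    have hx2 : ∀ s < D, ∀ a, form φ ((X : K[X]) ^ s • (form φ).symm (f a)) x = 0 :=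
      fun s hs a => hx (Sum.inr (⟨s, hs⟩, a))
    rw [mem_partialCotraj]
    intro i hi
    rw [hf]
    intro a
    have h1 : f a (((φ : V →ₗ[K] V) ^ i) x) =
        form φ ((X : K[X]) ^ i • (form φ).symm (f a)) x := by
      rw [form_X_pow_smul, LinearEquiv.apply_symm_apply]
    rw [h1]
    conv_lhs => rw [← EuclideanDomain.div_add_mod ((X : K[X]) ^ i) (p a), mul_comm (p a)]
    rw [add_smul, mul_smul, ← hq, Finset.smul_sum, map_add, map_sum]
    simp only [← mul_smul, add_apply, sum_apply]
    rw [Finset.sum_eq_zero, zero_add]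
    · refine form_smul_eq_zero_of_degree_lt (N := D) (fun s hs => hx2 s hs a) ?_
      refine (EuclideanDomain.mod_lt _ (hp a)).trans_le (degree_le_natDegree.trans ?_)
      exact_mod_cast Finset.le_sup (f := fun a => (p a).natDegree) (Finset.mem_univ a)
    · intro j _
      refine form_smul_eq_zero_of_degree_lt (N := n + c) (fun s hs => hx1 s hs j) ?_
      have hc : (q a j).natDegree ≤ c :=
        (Finset.le_sup (f := fun j => (q a j).natDegree) (Finset.mem_univ j)).trans
          (Finset.le_sup (f := fun a => Finset.univ.sup fun j => (q a j).natDegree)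
            (Finset.mem_univ a))
      have hd : ((X : K[X]) ^ i / p a).natDegree ≤ i := by
        simpa using natDegree_le_natDegree (degree_div_le ((X : K[X]) ^ i) (p a))
      refine degree_le_natDegree.trans_lt ?_
      have := natDegree_mul_le (p := (X : K[X]) ^ i / p a) (q := q a j)
      exact_mod_cast (by omega : ((X : K[X]) ^ i / p a * q a j).natDegree < n + c)
  · simp only [Fintype.card_sum, Fintype.card_prod, Fintype.card_fin]
    exact_mod_cast (by ring : (n + c) * r + D * m = r * n + (c * r + D * m)).le

/-- The topological entropy is the rank of the dual `K[X]`-module. -/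
theorem IsLinearlyCompact.topEntropy_eq_rank [IsTopologicalAddGroup V]
    (hV : IsLinearlyCompact K V) (φ : V →L[K] V) :
    topEntropy φ = (Cardinal.toENat (Module.rank K[X] (DualModule φ)) : ℕ∞) := by
  rcases lt_or_ge (Module.rank K[X] (DualModule φ)) Cardinal.aleph0 with h | h
  · obtain ⟨r, hr⟩ := Cardinal.lt_aleph0.1 h
    obtain ⟨b, hb⟩ := Module.le_rank_iff.1 hr.ge
    rw [hr, map_natCast, ENat.toENNReal_coe]
    exact le_antisymm (hV.topEntropy_le ((rank_eq_iff_of_linearIndependent hb).1 hr))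
      (hV.le_topEntropy hb)
  · rw [Cardinal.toENat_eq_top.2 h, ENat.toENNReal_top, eq_comm]
    refine (ENNReal.eq_top_of_forall_nnreal_le fun a => ?_).symm
    obtain ⟨n, hn⟩ := exists_nat_gt a
    obtain ⟨b, hb⟩ := Module.le_rank_iff.1 (Cardinal.natCast_le_aleph0.trans h)
    exact le_trans (by exact_mod_cast hn.le) (hV.le_topEntropy (r := n) hb)

theorem IsLinearlyCompact.topEntropy_eq_natCast_iff [IsTopologicalAddGroup V]
    (hV : IsLinearlyCompact K V) (φ : V →L[K] V) (k : ℕ) :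
    topEntropy φ = k ↔ Module.rank K[X] (DualModule φ) = k := by
  rw [hV.topEntropy_eq_rank, ← Cardinal.toENat_eq_natCast]
  norm_cast

theorem IsLinearlyCompact.topEntropy_eq_top_iff [IsTopologicalAddGroup V]
    (hV : IsLinearlyCompact K V) (φ : V →L[K] V) :
    topEntropy φ = ⊤ ↔ Cardinal.aleph0 ≤ Module.rank K[X] (DualModule φ) := by
  rw [hV.topEntropy_eq_rank, ← Cardinal.toENat_eq_top, ENat.toENNReal_eq_top]

end DualModule

/-! ### Cotrajectories as annihilators in the dual module -/

section Cocyclic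

open Polynomial

variable {K V : Type*} [Field K] [TopologicalSpace K] [DiscreteTopology K]
  [AddCommGroup V] [Module K V] [TopologicalSpace V] {φ : V →L[K] V}

/-- An element of the dual module whose annihilator is zero. -/
def IsTorsionFreeElement (w : DualModule φ) : Prop :=
  ∀ p : K[X], p • w = 0 → p = 0

theorem isTorsionFreeElement_of_linearIndependent {ι : Type*} {w : ι → DualModule φ}
    (hw : LinearIndependent K[X] w) (i : ι) : IsTorsionFreeElement (w i) := by
  intro p hp
  exact hw.eq_zero_of_smul_mem_span i p (by rw [hp]; exact zero_mem _)

theorem form_eq_zero_of_mem_span {ι : Type*} {w : ι → DualModule φ} {x : V}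
    (hx : ∀ i, x ∈ cotraj (φ : V →ₗ[K] V) (kerForm (w i))) {u : DualModule φ}
    (hu : u ∈ Submodule.span K[X] (Set.range w)) : form φ u x = 0 := by
  rw [Finsupp.mem_span_range_iff_exists_finsupp] at hu
  obtain ⟨c, rfl⟩ := hu
  rw [Finsupp.sum, map_sum, sum_apply]
  exact Finset.sum_eq_zero fun i _ => form_smul_eq_zero_of_mem_cotraj (hx i) _

/-- An element of the dual module annihilates an intersection of cotrajectories if and only if
it lies in the submodule generated by the corresponding elements. -/
theorem IsLinearlyCompact.form_eq_zero_iff_mem_span (hV : IsLinearlyCompact K V) {ι : Type*}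
    (w : ι → DualModule φ) (u : DualModule φ) :
    (∀ x, (∀ i, x ∈ cotraj (φ : V →ₗ[K] V) (kerForm (w i))) → form φ u x = 0) ↔
      u ∈ Submodule.span K[X] (Set.range w) := by
  refine ⟨fun h => ?_, fun hu x hx => form_eq_zero_of_mem_span hx hu⟩
  have h1 := hV.mem_span_range (fun q : ι × ℕ => form φ ((X : K[X]) ^ q.2 • w q.1)) (form φ u)
    (fun x hx => h x fun i => mem_cotraj_kerForm.2 fun n => hx (i, n))
  have h2 : Submodule.span K (Set.range fun q : ι × ℕ => form φ ((X : K[X]) ^ q.2 • w q.1)) ≤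
      ((Submodule.span K[X] (Set.range w)).restrictScalars K).map
        (form φ : DualModule φ →ₗ[K] (V →L[K] K)) := by
    rw [Submodule.span_le]
    rintro _ ⟨q, rfl⟩
    exact ⟨(X : K[X]) ^ q.2 • w q.1, Submodule.smul_mem (Submodule.span K[X] (Set.range w)) _
      (Submodule.subset_span ⟨q.1, rfl⟩), rfl⟩
  obtain ⟨u', hu', huu⟩ := h2 h1
  rwa [(form φ).injective huu] at hu'

/-- Given a relation `∑ pⱼ wⱼ = 0`, the form `pᵢ wᵢ` vanishes on the `i`-th cotrajectory and, being
minus the sum of the other terms, on the intersection of the others; coindependence makes it zero.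
Conversely, independence lets the values of all `Xⁿ wⱼ` be prescribed. -/
theorem IsLinearlyCompact.coindependent_cotraj_iff (hV : IsLinearlyCompact K V) {ι : Type*}
    {w : ι → DualModule φ} (hw : ∀ i, IsTorsionFreeElement (w i)) :
    Coindependent (fun i => cotraj (φ : V →ₗ[K] V) (kerForm (w i))) ↔
      LinearIndependent K[X] w := by
  classical
  constructor
  · rintro ⟨-, h⟩
    rw [linearIndependent_iff']
    intro s p hp i hi
    refine hw i _ ((form φ).injective ?_)
    ext x
    have hx : x ∈ (⊤ : Submodule K V) := Submodule.mem_top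
    rw [← h s i hi, Submodule.mem_sup] at hx
    obtain ⟨y, hy, z, hz, rfl⟩ := hx
    rw [← Finset.add_sum_erase s _ hi, add_eq_zero_iff_eq_neg] at hp
    have h1 : form φ (p i • w i) z = 0 := by
      rw [hp, map_neg, map_sum, neg_apply, sum_apply, Finset.sum_eq_zero, neg_zero]
      intro j hj
      simp only [Submodule.mem_iInf] at hz
      exact form_smul_eq_zero_of_mem_cotraj
        (hz j ⟨Finset.mem_of_mem_erase hj, Finset.ne_of_mem_erase hj⟩) _
    rw [map_add, form_smul_eq_zero_of_mem_cotraj hy, h1, map_zero, zero_add, zero_apply]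
  · intro h
    refine ⟨fun i hi => ?_, fun s i hi => ?_⟩
    · refine one_ne_zero (hw i 1 ((form φ).injective ?_))
      ext x
      rw [form_smul_eq_zero_of_mem_cotraj (x := x), map_zero, zero_apply]
      exact hi.ge Submodule.mem_top
    · rw [eq_top_iff]
      intro x _
      -- `y` is killed by every `Xⁿ wᵢ` and agrees with `x` under all other `Xⁿ wⱼ`, so `x = y + (x
      -- - y)` is the required decomposition.
      obtain ⟨y, hy⟩ := hV.exists_forall_eq_of_linearIndependent (linearIndependent_X_pow_smul h)
        (fun q => if q.2 = i then 0 else form φ ((X : K[X]) ^ q.1 • w q.2) x)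
      rw [Submodule.mem_sup]
      refine ⟨y, mem_cotraj_kerForm.2 fun n => ?_, x - y, ?_, add_sub_cancel _ _⟩
      · simpa using hy (n, i)
      · simp only [Submodule.mem_iInf]
        rintro j ⟨-, hj⟩
        refine mem_cotraj_kerForm.2 fun n => ?_
        have h1 := hy (n, j)
        rw [if_neg hj] at h1
        rw [map_sub, h1, sub_self]

theorem form_smul_restrictCotraj {ι : Sort*} {U : ι → Submodule K V}
    {u : DualModule φ} {u' : DualModule (restrictCotraj φ U)}
    (h : ∀ x, form _ u' x = form φ u x) (p : K[X])
    (x : (⨅ i, cotraj (φ : V →ₗ[K] V) (U i) : Submodule K V)) :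
    form _ (p • u') x = form φ (p • u) x := by
  have h1 : ∀ n : ℕ, ((((restrictCotraj φ U).toLinearMap) ^ n) x : V) =
      ((φ : V →ₗ[K] V) ^ n) x := by
    intro n
    induction n with
    | zero => rfl
    | succ n ih =>
      rw [pow_succ', pow_succ', Module.End.mul_apply, Module.End.mul_apply, ← ih]
      rfl
  simp only [form_smul, h, h1]

variable [IsTopologicalAddGroup V]

/-- An open cotrajectory is cut out by finitely many forms, whose span contains `K[X] w`;
infinite-dimensional `K[X]` cannot embed there. If `p • w = 0` with `p ≠ 0`, reduction modulo `p`
leaves only the finitely many conditions `Xⁱ w = 0`, `i < deg p`. -/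
theorem IsLinearlyCompact.isOpen_cotraj_kerForm_iff (hV : IsLinearlyCompact K V)
    (w : DualModule φ) :
    IsOpen (cotraj (φ : V →ₗ[K] V) (kerForm w) : Set V) ↔ ¬ IsTorsionFreeElement w := by
  constructor
  · intro hopen htf
    obtain ⟨f, hf⟩ := hV.exists_forms hopen
    let g : K[X] →ₗ[K] (V →L[K] K) :=
      (form φ : DualModule φ →ₗ[K] (V →L[K] K)).comp
        ((LinearMap.toSpanSingleton K[X] (DualModule φ) w).restrictScalars K)
    have hg : ∀ p, g p ∈ Submodule.span K (Set.range f) := fun p =>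
      hV.mem_span_range f _ fun x hx => form_smul_eq_zero_of_mem_cotraj ((hf x).2 hx) p
    have : IsNoetherian K (Submodule.span K (Set.range f)) :=
      isNoetherian_span_of_finite K (Set.finite_range f)
    refine Polynomial.not_finite (R := K)
      (Module.Finite.of_injective (g.codRestrict _ hg) ?_)
    refine (injective_iff_map_eq_zero _).2 fun p hp => ?_
    refine htf p ((form φ).injective ?_)
    rw [map_zero]
    exact Subtype.ext_iff.1 hp
  · intro h
    rw [IsTorsionFreeElement] at h
    push Not at h
    obtain ⟨p, hpw, hp⟩ := h
    have hopen : IsOpen ((⨅ i : Fin p.natDegree, kerForm ((X : K[X]) ^ (i : ℕ) • w) :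
        Submodule K V) : Set V) := by
      rw [Submodule.coe_iInf]
      exact isOpen_iInter_of_finite fun i => isOpen_kerForm _
    refine isOpen_submodule_of_le hopen fun x hx => ?_
    simp only [Submodule.mem_iInf, mem_kerForm] at hx
    rw [mem_cotraj_kerForm]
    intro n
    rw [← EuclideanDomain.mod_add_div ((X : K[X]) ^ n) p, mul_comm p, add_smul, mul_smul, hpw,
      smul_zero, add_zero]
    refine form_smul_eq_zero_of_degree_lt (N := p.natDegree) (fun s hs => hx ⟨s, hs⟩) ?_
    exact (EuclideanDomain.mod_lt _ hp).trans_le degree_le_natDegree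

theorem IsLinearlyCompact.isNonstationaryCocyclic_iff (hV : IsLinearlyCompact K V)
    (U : Submodule K V) :
    IsNonstationaryCocyclic φ U ↔ ∃ w : DualModule φ, IsTorsionFreeElement w ∧ U = kerForm w := by
  constructor
  · intro h
    obtain ⟨f, hf⟩ := hV.exists_forms h.mem_openLC.1
    generalize hm : Module.finrank K (V ⧸ U) = m at f hf
    obtain rfl : m = 1 := hm.symm.trans h.cocyclic
    have hU : U = kerForm ((form φ).symm (f 0)) := by
      ext x
      simp [hf]
    refine ⟨(form φ).symm (f 0), ?_, hU⟩
    have h1 := h.nonstationary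
    rwa [hU, hV.isOpen_cotraj_kerForm_iff, not_not] at h1
  · rintro ⟨w, hw, rfl⟩
    refine ⟨hV.mem_openLC_iff.2 (isOpen_kerForm w), ?_, ?_⟩
    · have hne : (form φ w : V →ₗ[K] K) ≠ 0 := by
        intro h
        have h1 : w = 0 := by
          refine (form φ).injective ?_
          ext x
          simpa using LinearMap.congr_fun h x
        exact one_ne_zero (hw 1 (by rw [h1, smul_zero]))
      exact (LinearMap.quotKerEquivOfSurjective _ (LinearMap.surjective hne)).finrank_eq.trans
        (Module.finrank_self K)
    · rwa [hV.isOpen_cotraj_kerForm_iff, not_not]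

theorem isClosed_iInf_cotraj {ι : Type*} (w : ι → DualModule φ) :
    IsClosed ((⨅ i, cotraj (φ : V →ₗ[K] V) (kerForm (w i)) : Submodule K V) : Set V) := by
  have h1 : ((⨅ i, cotraj (φ : V →ₗ[K] V) (kerForm (w i)) : Submodule K V) : Set V) =
      ⋂ (i) (n : ℕ), (kerForm ((X : K[X]) ^ n • w i) : Set V) := by
    ext x
    simp only [SetLike.mem_coe, Submodule.mem_iInf, Set.mem_iInter, mem_cotraj_kerForm,
      mem_kerForm]
  rw [h1]
  exact isClosed_iInter fun i => isClosed_iInter fun n =>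
    isClosed_submodule_of_isOpen (isOpen_kerForm _)

/-- The restriction to an intersection of cotrajectories has entropy zero if and only if the
corresponding quotient of the dual module is torsion. -/
theorem IsLinearlyCompact.topEntropy_restrictCotraj_eq_zero_iff (hV : IsLinearlyCompact K V)
    {ι : Type*} (w : ι → DualModule φ) :
    topEntropy (restrictCotraj φ fun i => kerForm (w i)) = 0 ↔
      ∀ u : DualModule φ, ∃ p : K[X], p ≠ 0 ∧ p • u ∈ Submodule.span K[X] (Set.range w) := by
  have hC := hV.of_isClosed (isClosed_iInf_cotraj w)
  have h0 := hC.topEntropy_eq_natCast_iff (restrictCotraj φ fun i => kerForm (w i)) 0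
  rw [Nat.cast_zero, Nat.cast_zero] at h0
  rw [h0, rank_eq_zero_iff]
  -- `p • u'` is the restriction of `p • u` to `C`, and forms vanishing on `C` are those in the
  -- span.
  have key : ∀ (u : DualModule φ) (u' : DualModule (restrictCotraj φ fun i => kerForm (w i)))
      (_ : ∀ x, form _ u' x = form φ u x) (p : K[X]),
      p • u' = 0 ↔ p • u ∈ Submodule.span K[X] (Set.range w) := by
    intro u u' h p
    rw [← hV.form_eq_zero_iff_mem_span, ← (form _).map_eq_zero_iff, ContinuousLinearMap.ext_iff]
    simp only [form_smul_restrictCotraj h, zero_apply, Subtype.forall, Submodule.mem_iInf]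
  constructor
  · intro h u
    let u' := (form (restrictCotraj φ fun i => kerForm (w i))).symm
      ((form φ u).comp (Submodule.subtypeL _))
    obtain ⟨p, hp, hpu⟩ := h u'
    refine ⟨p, hp, (key u u' (fun x => ?_) p).1 hpu⟩
    simp [u']
  · intro h u'
    -- Every form on `C` extends to `V`, so the torsion condition on the quotient reaches all of the
    -- dual of `C`.
    obtain ⟨g, hg⟩ := hV.exists_extension _ (form _ u')
    obtain ⟨p, hp, hpu⟩ := h ((form φ).symm g)
    exact ⟨p, hp, (key _ u' (fun x => by simp [hg]) p).2 hpu⟩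

end Cocyclic

end TopFlow

theorem theoremA {K V : Type*} [Field K] [TopologicalSpace K] [DiscreteTopology K]
    [AddCommGroup V] [Module K V] [TopologicalSpace V] [IsTopologicalAddGroup V]
    [ContinuousSMul K V] (hV : TopFlow.IsLinearlyCompact K V) (φ : V →L[K] V) :
    (∀ k : ℕ, TopFlow.topEntropy φ = (k : ENNReal) ↔
      ∃ U : Fin k → Submodule K V,
        (∀ i, TopFlow.IsNonstationaryCocyclic φ (U i)) ∧
        TopFlow.Coindependent (fun i => TopFlow.cotraj (φ : V →ₗ[K] V) (U i)) ∧
        TopFlow.topEntropy (TopFlow.restrictCotraj φ U) = 0) ∧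
    (TopFlow.topEntropy φ = ⊤ ↔
      ∃ U : ℕ → Submodule K V,
        (∀ i, TopFlow.IsNonstationaryCocyclic φ (U i)) ∧
        TopFlow.Coindependent (fun i => TopFlow.cotraj (φ : V →ₗ[K] V) (U i))) := by
  refine ⟨fun k => ?_, ?_⟩
  · rw [hV.topEntropy_eq_natCast_iff]
    constructor
    · intro hk
      obtain ⟨w, hw⟩ := Module.le_rank_iff.1 hk.ge
      have htf := TopFlow.isTorsionFreeElement_of_linearIndependent hw
      refine ⟨fun i => TopFlow.kerForm (w i),
        fun i => (hV.isNonstationaryCocyclic_iff _).2 ⟨w i, htf i, rfl⟩,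
        (hV.coindependent_cotraj_iff htf).2 hw, ?_⟩
      rw [hV.topEntropy_restrictCotraj_eq_zero_iff]
      exact (TopFlow.rank_eq_iff_of_linearIndependent hw).1 hk
    · rintro ⟨U, hU, hco, hent⟩
      choose w htf hUw using fun i => (hV.isNonstationaryCocyclic_iff _).1 (hU i)
      obtain rfl : U = fun i => TopFlow.kerForm (w i) := funext hUw
      rw [hV.topEntropy_restrictCotraj_eq_zero_iff] at hent
      exact (TopFlow.rank_eq_iff_of_linearIndependent
        ((hV.coindependent_cotraj_iff htf).1 hco)).2 hent
  · rw [hV.topEntropy_eq_top_iff]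
    constructor
    · intro h
      -- Over a domain the rank is attained by an independent set, so infinite rank gives one
      -- infinite independent set, not merely arbitrarily large finite ones.
      obtain ⟨s, hs, hli⟩ :=
        exists_set_linearIndependent_of_isDomain (Polynomial K) (TopFlow.DualModule φ)
      rw [← hs, Cardinal.aleph0_le_mk_iff] at h
      have hw := hli.linearIndependent.comp _ (Infinite.natEmbedding s).injective
      have htf := TopFlow.isTorsionFreeElement_of_linearIndependent hw
      exact ⟨_, fun i => (hV.isNonstationaryCocyclic_iff _).2 ⟨_, htf i, rfl⟩,
        (hV.coindependent_cotraj_iff htf).2 hw⟩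
    · rintro ⟨U, hU, hco⟩
      choose w htf hUw using fun i => (hV.isNonstationaryCocyclic_iff _).1 (hU i)
      obtain rfl : U = fun i => TopFlow.kerForm (w i) := funext hUw
      have := ((hV.coindependent_cotraj_iff htf).1 hco).cardinal_lift_le_rank
      simpa using this
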